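/- Let $k$ be a field, let $n\le m$ be non-negative integers, let $R=k[x_{ij}\mid 1\le i\le n,\ 1\le j\le m]$ with its standard grading, and let $M=(x_{ij})$ be the generic $n\times m$ matrix, viewed as a map $M:F\to G$ of free $R$-modules with bases $f_1,\dots,f_m$ and $g_1,\dots,g_n$. Let $<$ be the lexicographic order on $R$ with $x_{11}>x_{12}>\cdots>x_{1m}>x_{21}>\cdots>x_{nm}$. Let $\Delta$ be a simplicial complex on the vertex set $[m]$, i.e. a family of subsets of $[m]$ closed under taking subsets. Let $\mathcal C^<_\bullet(\Delta,M)$ be the following complex of graded free $R$-modules. Put $\mathcal C^<_0(\Delta,M)=\bigwedge^nG\cong R$, generated in degree $0$. For $i\ge1$ let $\mathcal C^<_i(\Delta,M)\subseteq D_{i-1}(G^*)\otimes\bigwedge^{n+i-1}F$ be the free submodule with basis the elements $g^{*(\alpha)}\otimes f_\sigma$ with $\alpha=(\alpha_1,\dots,\alpha_n)\in\mathbb Z_{\ge0}^n$, $|\alpha|=i-1$, $\sigma\in\Delta$, $|\sigma|=n+i-1$; these basis elements have degree $n+i-1$. The first differential is $d_1(f_\sigma)=\operatorname{in}_<(\det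 M_\sigma)$, the initial term of the maximal minor of $M$ on the columns in $\sigma$. For $\ell\ge2$ and $\sigma=\{\sigma_1<\cdots<\sigma_{n+\ell-1}\}$, $$d_\ell(g^{*(\alpha)}\otimes f_\sigma)=\sum_{(i,\sigma_j)\in\mathcal I_<(\alpha,\sigma)}(-1)^{j+1}x_{i\sigma_j}\,g^{*(\alpha-\epsilon_i)}\otimes f_{\sigma\setminus\sigma_j},$$ where $\epsilon_i$ is the $i$-th unit vector and $\mathcal I_<(\alpha,\sigma)=\{(i,\sigma_{i+j})\mid \alpha_i>0,\ \alpha_1+\cdots+\alpha_{i-1}\le j\le\alpha_1+\cdots+\alpha_i\}$. A $1$-nonface of $\Delta$ is a set $\sigma=\{\sigma_1<\cdots<\sigma_l\}\subseteq[m]$ with $\sigma\notin\Delta$ such that for some $1\le j<l$ both $\sigma\setminus\sigma_j$ and $\sigma\setminus\sigma_{j+1}$ belong to $\Delta$. Then the following are equivalent: 1. $H_1(\mathcal C^<_\bullet(\Delta,M))_{n+1}=0$; 2. $\Delta$ has no $1$-nonfaces of cardinality $n+1$. Moreover, if $\sigma\notin\Delta$ has cardinality $n+1$ and $\sigma\setminus\sigma_j,\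 \sigma\setminus\sigma_{j+1}\in\Delta$ for some $1\le j\le n$, then $$z=(-1)^{j+1}\bigl(x_{j\sigma_j}f_{\sigma\setminus\sigma_j}-x_{j\sigma_{j+1}}f_{\sigma\setminus\sigma_{j+1}}\bigr)\in\mathcal C^<_1(\Delta,M)$$ is a cycle that is not a boundary. -/

import Mathlib

open CategoryTheory

noncomputable section

namespace SparseEN

universe u

/-- The polynomial ring `k[x_{ij} | 1 ≤ i ≤ n, 1 ≤ j ≤ m]`. All indices are shifted to start at
`0`. The variables are indexed by the lexicographically ordered product, so that for the order
`MonomialOrder.lex` one has `x_{11} > x_{12} > ⋯ > x_{1m} > x_{21} > ⋯ > x_{nm}`. -/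
abbrev PolyRing (k : Type u) [Field k] (n m : ℕ) : Type u := MvPolynomial (Fin n ×ₗ Fin m) k

/-- The variable `x_{ij}`. -/
abbrev x (k : Type u) [Field k] {n m : ℕ} (i : Fin n) (j : Fin m) : PolyRing k n m :=
  MvPolynomial.X (toLex (i, j))

/-- The generic `n × m` matrix `M = (x_{ij})`. -/
def genericMatrix (k : Type u) [Field k] (n m : ℕ) : Matrix (Fin n) (Fin m) (PolyRing k n m) :=
  Matrix.of fun i j => x k i j

/-- The maximal minor of `M` on the columns `I = {i_1 < ⋯ < i_n}`; this is the coefficient of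
`⋀ⁿ M (f_I)` with respect to the basis `g_1 ∧ ⋯ ∧ g_n` of `⋀ⁿ G`. -/
def maxMinor (k : Type u) [Field k] {n m : ℕ} (I : Finset (Fin m)) (h : I.card = n) :
    PolyRing k n m :=
  ((genericMatrix k n m).submatrix id (I.orderEmbOfFin h)).det

/-- The ambient free module with basis the symbols `g^{*(α)} ⊗ f_σ`, for all multi-indices
`α = (α_1, …, α_n)` and all `σ ⊆ [m]`, that is `⨁_{a, b} D_a(G^*) ⊗ ⋀^b F`. -/
abbrev Ambient (k : Type u) [Field k] (n m : ℕ) : Type u :=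
  ((Fin n → ℕ) × Finset (Fin m)) →₀ PolyRing k n m

/-- The basis element `g^{*(α)} ⊗ f_σ`. -/
def basisElt (k : Type u) [Field k] {n m : ℕ} (α : Fin n → ℕ) (σ : Finset (Fin m)) :
    Ambient k n m :=
  Finsupp.single (α, σ) 1

/-- The position, counted from `0`, of an element `v` of `σ = {σ_0 < σ_1 < ⋯}`. -/
def pos {m : ℕ} (σ : Finset (Fin m)) (v : Fin m) : ℕ := (σ.filter (· < v)).card

/-- The indexing set `I_<(α, σ)`: the pairs `(i, σ_{i+j})` with `α_i > 0` and
`|α_{≤ i-1}| ≤ j ≤ |α_{≤ i}|`. (Both `i` and positions are shifted by one, so that the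
relation "position = `i + j`" is unchanged.) -/
def indexSet {n m : ℕ} (α : Fin n → ℕ) (σ : Finset (Fin m)) : Finset (Fin n × Fin m) :=
  Finset.univ.filter fun p => 0 < α p.1 ∧ p.2 ∈ σ ∧
    p.1.val + ∑ l ∈ Finset.Iio p.1, α l ≤ pos σ p.2 ∧
    pos σ p.2 ≤ p.1.val + ∑ l ∈ Finset.Iic p.1, α l

/-- The sparse Eagon-Northcott differential
`g^{*(α)} ⊗ f_σ ↦ ∑_{(i, σ_j) ∈ I_<(α, σ)} (-1)^{j+1} x_{i σ_j} g^{*(α - ε_i)} ⊗ f_{σ \ σ_j}`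
(the sign is `(-1)^j` when `j` is counted from `0`). -/
def sparseDiff (k : Type u) [Field k] (n m : ℕ) :
    Ambient k n m →ₗ[PolyRing k n m] Ambient k n m :=
  Finsupp.linearCombination (PolyRing k n m) fun b =>
    ∑ p ∈ indexSet b.1 b.2, ((-1) ^ pos b.2 p.2 * x k p.1 p.2) •
      basisElt k (b.1 - Pi.single p.1 1) (b.2.erase p.2)

open Classical in
/-- The first differential `f_I ↦ in_<(M(f_I))`, for `I` of cardinality `n`. Here `⋀ⁿ G` is
identified with the ring through its basis `g_1 ∧ ⋯ ∧ g_n`; the value on the basis elements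
with `|I| ≠ n`, none of which lies in the first module of the complex, is irrelevant. -/
def initialDiff (k : Type u) [Field k] (n m : ℕ) :
    Ambient k n m →ₗ[PolyRing k n m] PolyRing k n m :=
  Finsupp.linearCombination (PolyRing k n m) fun b =>
    if h : b.2.card = n then MonomialOrder.lex.leadingTerm (maxMinor k b.2 h) else 0

/-- The module `C^<_{i+1}(Δ, M)` for `i ≥ 0`: the free submodule of `D_i(G^*) ⊗ ⋀^{n+i} F`
generated by all `g^{*(α)} ⊗ f_σ` with `|α| = i`, `|σ| = n + i` and `σ ∈ Δ`. A simplicial complex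
on `[m]` is a family of subsets of `[m]` that is closed under passing to subsets. -/
def chains (k : Type u) [Field k] (n : ℕ) {m : ℕ} (Δ : LowerSet (Finset (Fin m))) (i : ℕ) :
    Submodule (PolyRing k n m) (Ambient k n m) :=
  Submodule.span _ {c | ∃ (α : Fin n → ℕ) (σ : Finset (Fin m)),
    ∑ l, α l = i ∧ σ.card = n + i ∧ σ ∈ Δ ∧ c = basisElt k α σ}

section

variable {k : Type u} [Field k] {n m : ℕ}

theorem sparseDiff_basisElt (α : Fin n → ℕ) (σ : Finset (Fin m)) :
    sparseDiff k n m (basisElt k α σ) =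
      ∑ p ∈ indexSet α σ, ((-1) ^ pos σ p.2 * x k p.1 p.2) •
        basisElt k (α - Pi.single p.1 1) (σ.erase p.2) := by
  simp [sparseDiff, basisElt, Finsupp.linearCombination_single]

theorem sum_sub_single (α : Fin n → ℕ) (i : Fin n) (hi : 0 < α i) (s : Finset (Fin n)) :
    ∑ l ∈ s, α l = ∑ l ∈ s, (α - Pi.single i 1 : Fin n → ℕ) l + (if i ∈ s then 1 else 0) := by
  have h1 : ∀ l, α l = (α - Pi.single i 1 : Fin n → ℕ) l + (if i = l then 1 else 0) := by
    intro l
    by_cases h : i = l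
    · subst h; simp; omega
    · simp [h, Ne.symm h]
  rw [Finset.sum_congr rfl fun l _ => h1 l, Finset.sum_add_distrib, Finset.sum_ite_eq]

theorem sparseDiff_mem (Δ : LowerSet (Finset (Fin m))) (i : ℕ) :
    ∀ c ∈ chains k n Δ (i + 1), sparseDiff k n m c ∈ chains k n Δ i := by
  suffices h : chains k n Δ (i + 1) ≤ (chains k n Δ i).comap (sparseDiff k n m) from h
  refine Submodule.span_le.2 ?_
  rintro _ ⟨α, σ, hα, hc, hσ, rfl⟩
  simp only [Submodule.comap_coe, Set.mem_preimage, SetLike.mem_coe, sparseDiff_basisElt]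
  refine Submodule.sum_mem _ fun p hp => Submodule.smul_mem _ _ (Submodule.subset_span ?_)
  simp only [indexSet, Finset.mem_filter, Finset.mem_univ, true_and] at hp
  refine ⟨_, _, ?_, ?_, Δ.lower (Finset.erase_subset _ _) hσ, rfl⟩
  · have := sum_sub_single α p.1 hp.1 Finset.univ
    simp only [Finset.mem_univ, if_true] at this
    omega
  · rw [Finset.card_erase_of_mem hp.2.1]; omega

theorem pos_erase (σ : Finset (Fin m)) (u v : Fin m) (hu : u ∈ σ) :
    pos σ v = pos (σ.erase u) v + (if u < v then 1 else 0) := by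
  unfold pos
  rw [Finset.filter_erase]
  split_ifs with h
  · rw [Finset.card_erase_add_one]; simp [hu, h]
  · rw [Finset.erase_eq_of_notMem]; simp; simp [h]

theorem pos_lt (σ : Finset (Fin m)) (u v : Fin m) (hu : u ∈ σ) (h : u < v) :
    pos σ u < pos σ v := by
  refine Finset.card_lt_card (Finset.ssubset_iff_of_subset ?_ |>.2 ⟨u, ?_, ?_⟩)
  · intro w; simp only [Finset.mem_filter]; exact fun hw => ⟨hw.1, hw.2.trans h⟩
  · simp [hu, h]
  · simp

theorem indexSet_swap (α : Fin n → ℕ) (σ : Finset (Fin m)) (p q : Fin n × Fin m)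
    (hp : p ∈ indexSet α σ) (hq : q ∈ indexSet (α - Pi.single p.1 1) (σ.erase p.2)) :
    q ∈ indexSet α σ ∧ p ∈ indexSet (α - Pi.single q.1 1) (σ.erase q.2) := by
  obtain ⟨a, u⟩ := p
  obtain ⟨b, v⟩ := q
  simp only [indexSet, Finset.mem_filter, Finset.mem_univ, true_and, Finset.mem_erase] at *
  obtain ⟨ha, hu, hp1, hp2⟩ := hp
  obtain ⟨hb, ⟨hvu, hv⟩, hq1, hq2⟩ := hq
  have hb' : 0 < α b := lt_of_lt_of_le hb (by simp)
  have e1 := sum_sub_single α a ha (Finset.Iio b)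
  have e2 := sum_sub_single α a ha (Finset.Iic b)
  have e3 := sum_sub_single α b hb' (Finset.Iio a)
  have e4 := sum_sub_single α b hb' (Finset.Iic a)
  have s1 := Finset.sum_Iio_add_eq_sum_Iic (f := α) a
  have s2 := Finset.sum_Iio_add_eq_sum_Iic (f := α) b
  have r1 := pos_erase σ u v hu
  have r2 := pos_erase σ v u hv
  simp only [Finset.mem_Iio, Finset.mem_Iic] at e1 e2 e3 e4
  have huv : (u < v ∧ ¬ v < u ∧ pos σ u < pos σ v) ∨ (v < u ∧ ¬ u < v ∧ pos σ v < pos σ u) := by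
    rcases lt_or_gt_of_ne hvu with h | h
    · exact Or.inr ⟨h, h.asymm, pos_lt σ v u hv h⟩
    · exact Or.inl ⟨h, h.asymm, pos_lt σ u v hu h⟩
  rcases lt_trichotomy a b with hab | hab | hab
  · have hs : ∑ l ∈ Finset.Iic a, α l ≤ ∑ l ∈ Finset.Iio b, α l :=
      Finset.sum_le_sum_of_subset fun w hw =>
        Finset.mem_Iio.2 ((Finset.mem_Iic.1 hw).trans_lt hab)
    have h0 : (α - Pi.single b 1 : Fin n → ℕ) a = α a := by simp [hab.ne]
    have hab' : a.val < b.val := hab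
    simp only [hab, hab.le, hab.not_ge, hab.asymm, if_true, if_false] at e1 e2 e3 e4
    rw [h0]
    rcases huv with ⟨h1, h2, h3⟩ | ⟨h1, h2, h3⟩ <;> simp only [h1, h2, if_true, if_false] at r1 r2 <;>
      refine ⟨⟨hb', hv, ?_, ?_⟩, ha, ⟨hvu.symm, hu⟩, ?_, ?_⟩ <;> omega
  · subst hab
    simp only [lt_irrefl, le_refl, if_true, if_false] at e1 e2 e3 e4
    rcases huv with ⟨h1, h2, h3⟩ | ⟨h1, h2, h3⟩ <;> simp only [h1, h2, if_true, if_false] at r1 r2 <;>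
      refine ⟨⟨hb', hv, ?_, ?_⟩, hb, ⟨hvu.symm, hu⟩, ?_, ?_⟩ <;> omega
  · have hs : ∑ l ∈ Finset.Iic b, α l ≤ ∑ l ∈ Finset.Iio a, α l :=
      Finset.sum_le_sum_of_subset fun w hw =>
        Finset.mem_Iio.2 ((Finset.mem_Iic.1 hw).trans_lt hab)
    have h0 : (α - Pi.single b 1 : Fin n → ℕ) a = α a := by simp [hab.ne']
    have hab' : b.val < a.val := hab
    simp only [hab, hab.le, hab.not_ge, hab.asymm, if_true, if_false] at e1 e2 e3 e4
    rw [h0]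
    rcases huv with ⟨h1, h2, h3⟩ | ⟨h1, h2, h3⟩ <;> simp only [h1, h2, if_true, if_false] at r1 r2 <;>
      refine ⟨⟨hb', hv, ?_, ?_⟩, ha, ⟨hvu.symm, hu⟩, ?_, ?_⟩ <;> omega

theorem sparseDiff_sparseDiff_basisElt (α : Fin n → ℕ) (σ : Finset (Fin m)) :
    sparseDiff k n m (sparseDiff k n m (basisElt k α σ)) = 0 := by
  rw [sparseDiff_basisElt, map_sum]
  simp only [map_smul, sparseDiff_basisElt, Finset.smul_sum]
  rw [Finset.sum_sigma']
  have key : ∀ z ∈ (indexSet α σ).sigma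
      fun p => indexSet (α - Pi.single p.1 1) (σ.erase p.2),
      z.1 ∈ indexSet α σ ∧ z.2 ∈ indexSet (α - Pi.single z.1.1 1) (σ.erase z.1.2) :=
    fun z hz => Finset.mem_sigma.1 hz
  have hne : ∀ z ∈ (indexSet α σ).sigma
      fun p => indexSet (α - Pi.single p.1 1) (σ.erase p.2),
      z.1.2 ∈ σ ∧ z.2.2 ∈ σ ∧ z.2.2 ≠ z.1.2 := by
    intro z hz
    have h1 := (key z hz).1
    have h2 := (key z hz).2
    simp only [indexSet, Finset.mem_filter, Finset.mem_univ, true_and, Finset.mem_erase] at h1 h2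
    exact ⟨h1.2.1, h2.2.1.2, h2.2.1.1⟩
  refine Finset.sum_involution (fun z _ => ⟨z.2, z.1⟩) ?_ ?_ ?_ ?_
  · intro z hz
    obtain ⟨hu, hv, hvu⟩ := hne z hz
    have r1 := pos_erase σ z.1.2 z.2.2 hu
    have r2 := pos_erase σ z.2.2 z.1.2 hv
    rw [smul_smul, smul_smul, Finset.erase_right_comm, tsub_right_comm, ← add_smul]
    refine (congrArg (· • _) ?_).trans (zero_smul (PolyRing k n m) _)
    rcases lt_or_gt_of_ne hvu with h | h
    · simp only [h, h.asymm, if_true, if_false, add_zero] at r1 r2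
      rw [r1, r2]; ring
    · simp only [h, h.asymm, if_true, if_false, add_zero] at r1 r2
      rw [r1, r2]; ring
  · intro z hz _ h
    have := congrArg (fun w => w.1.2) h
    exact (hne z hz).2.2 this
  · intro z hz
    exact Finset.mem_sigma.2 (indexSet_swap α σ z.1 z.2 (key z hz).1 (key z hz).2)
  · intro z hz; rfl

theorem sparseDiff_sparseDiff (c : Ambient k n m) :
    sparseDiff k n m (sparseDiff k n m c) = 0 := by
  suffices h : (sparseDiff k n m).comp (sparseDiff k n m) = 0 from LinearMap.congr_fun h c
  refine Finsupp.lhom_ext' fun b => LinearMap.ext_ring ?_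
  exact sparseDiff_sparseDiff_basisElt b.1 b.2

theorem orderEmb_erase (σ : Finset (Fin m)) (h : σ.card = n + 1) (p : Fin (n + 1))
    (h' : (σ.erase (σ.orderEmbOfFin h p)).card = n) (a : Fin n) :
    (σ.erase (σ.orderEmbOfFin h p)).orderEmbOfFin h' a = σ.orderEmbOfFin h (p.succAbove a) := by
  refine (congrFun (Finset.orderEmbOfFin_unique h'
    (f := fun a => σ.orderEmbOfFin h (p.succAbove a)) (fun b => ?_) ?_) a).symm
  · simp [Finset.mem_erase, Finset.orderEmbOfFin_mem, Fin.succAbove_ne]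
  · exact (σ.orderEmbOfFin h).strictMono.comp (Fin.strictMono_succAbove p)

theorem pos_orderEmb (σ : Finset (Fin m)) {l : ℕ} (h : σ.card = l) (j : Fin l) :
    pos σ (σ.orderEmbOfFin h j) = j := by
  have : σ.filter (· < σ.orderEmbOfFin h j) =
      (Finset.Iio j).map (σ.orderEmbOfFin h).toEmbedding := by
    ext v
    simp only [Finset.mem_filter, Finset.mem_map, Finset.mem_Iio]
    constructor
    · rintro ⟨hv, hlt⟩
      have : v ∈ Set.range (σ.orderEmbOfFin h) := by simpa using hv
      obtain ⟨a, rfl⟩ := this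
      exact ⟨a, by simpa using hlt, rfl⟩
    · rintro ⟨a, ha, rfl⟩
      exact ⟨Finset.orderEmbOfFin_mem _ _ _, by simpa using ha⟩
  rw [pos, this]; simp

/-- The exponent of the monomial `∏ᵢ x_{i, c(i)}`. -/
def rowExp (c : Fin n → Fin m) : (Fin n ×ₗ Fin m) →₀ ℕ :=
  ∑ i, Finsupp.single (toLex (i, c i)) 1

theorem rowExp_apply (c : Fin n → Fin m) (a : Fin n) (v : Fin m) :
    rowExp c (toLex (a, v)) = if c a = v then 1 else 0 := by
  simp only [rowExp, Finsupp.finsetSum_apply, Finsupp.single_apply, toLex_inj, Prod.mk.injEq]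
  rw [Finset.sum_eq_single a] <;> simp +contextual

theorem rowExp_lt (c : Fin n → Fin m) (hc : StrictMono c) (π : Equiv.Perm (Fin n)) (hπ : π ≠ 1) :
    toLex (rowExp (fun i => c (π i))) < toLex (rowExp c) := by
  have hex : ∃ a, π a ≠ a := by
    by_contra! h
    exact hπ (Equiv.ext h)
  obtain ⟨a, ha, hmin⟩ := WellFounded.has_min (wellFounded_lt (α := Fin n)) {a | π a ≠ a} hex
  have hfix : ∀ b < a, π b = b := fun b hb => by
    by_contra h
    exact hmin b h hb
  have hlt : a < π a := by
    rcases lt_trichotomy a (π a) with h | h | h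
    · exact h
    · exact absurd h.symm ha
    · exact absurd (π.injective (hfix _ h)) ha
  rw [Finsupp.Lex.lt_iff]
  refine ⟨toLex (a, c a), ?_, ?_⟩
  · intro j hj
    obtain ⟨⟨b, v⟩, rfl⟩ := toLex.surjective j
    change rowExp _ (toLex (b, v)) = rowExp _ (toLex (b, v))
    rw [rowExp_apply, rowExp_apply]
    rcases Prod.Lex.toLex_lt_toLex.1 hj with h | ⟨h, h'⟩
    · rw [hfix b h]
    · simp only at h h'
      subst h
      rw [if_neg (h'.trans (hc hlt)).ne', if_neg h'.ne']
  · change rowExp _ (toLex (a, c a)) < rowExp _ (toLex (a, c a))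
    rw [rowExp_apply, rowExp_apply, if_neg (hc hlt).ne', if_pos rfl]
    exact zero_lt_one

theorem leadingTerm_maxMinor (I : Finset (Fin m)) (h : I.card = n) :
    MonomialOrder.lex.leadingTerm (maxMinor k I h) = ∏ i, x k i (I.orderEmbOfFin h i) := by
  set c : Fin n → Fin m := fun i => I.orderEmbOfFin h i with hcdef
  have hc : StrictMono c := (I.orderEmbOfFin h).strictMono
  have hprod : ∀ d : Fin n → Fin m, ∏ i, x k i (d i) = MvPolynomial.monomial (rowExp d) 1 := by
    intro d
    rw [rowExp, MvPolynomial.monomial_sum_one]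
    rfl
  have hdet : maxMinor k I h = ∑ π : Equiv.Perm (Fin n), Equiv.Perm.sign π •
      MvPolynomial.monomial (rowExp fun i => c (π i)) (1 : k) := by
    rw [maxMinor, ← Matrix.det_transpose, Matrix.det_apply]
    refine Finset.sum_congr rfl fun π _ => ?_
    rw [← hprod]
    rfl
  have hcoeff : ∀ u, MvPolynomial.coeff u (maxMinor k I h) = ∑ π : Equiv.Perm (Fin n),
      Equiv.Perm.sign π • (if rowExp (fun i => c (π i)) = u then (1 : k) else 0) := by
    intro u
    rw [hdet, MvPolynomial.coeff_sum]
    refine Finset.sum_congr rfl fun π _ => ?_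
    rw [Units.smul_def, Units.smul_def, MvPolynomial.coeff_smul, MvPolynomial.coeff_monomial]
  have hone : MvPolynomial.coeff (rowExp c) (maxMinor k I h) = 1 := by
    rw [hcoeff, Finset.sum_eq_single 1]
    · simp
    · intro π _ hπ
      rw [if_neg, smul_zero]
      intro he
      exact (rowExp_lt c hc π hπ).ne (congrArg toLex he)
    · simp
  have hdeg : MonomialOrder.lex.degree (maxMinor k I h) = rowExp c := by
    apply MonomialOrder.lex.toSyn.injective
    apply le_antisymm
    · rw [MonomialOrder.degree_le_iff]
      intro u hu
      rw [MvPolynomial.mem_support_iff, hcoeff] at hu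
      obtain ⟨π, -, hπ⟩ := Finset.exists_ne_zero_of_sum_ne_zero hu
      have hu' : rowExp (fun i => c (π i)) = u := by
        by_contra hne
        rw [if_neg hne, smul_zero] at hπ
        exact hπ rfl
      rw [MonomialOrder.lex_le_iff, ← hu']
      by_cases h1 : π = 1
      · subst h1; rfl
      · exact (rowExp_lt c hc π h1).le
    · exact MonomialOrder.le_degree (by rw [MvPolynomial.mem_support_iff, hone]; exact one_ne_zero)
  rw [MonomialOrder.leadingTerm, MonomialOrder.leadingCoeff, hdeg, hone, ← hprod]

theorem initialDiff_basisElt (α : Fin n → ℕ) (σ : Finset (Fin m)) (h : σ.card = n) :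
    initialDiff k n m (basisElt k α σ) = ∏ i, x k i (σ.orderEmbOfFin h i) := by
  simp [initialDiff, basisElt, Finsupp.linearCombination_single, h, leadingTerm_maxMinor]

theorem indexSet_single (i : Fin n) (σ : Finset (Fin m)) (h : σ.card = n + 1) :
    indexSet (Pi.single i 1) σ =
      {(i, σ.orderEmbOfFin h i.castSucc), (i, σ.orderEmbOfFin h i.succ)} := by
  have hs1 : ∑ l ∈ Finset.Iio i, (Pi.single i 1 : Fin n → ℕ) l = 0 :=
    Finset.sum_eq_zero fun l hl => by simp [(Finset.mem_Iio.1 hl).ne]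
  have hs2 := Finset.sum_Iio_add_eq_sum_Iic (f := (Pi.single i 1 : Fin n → ℕ)) i
  rw [hs1, Pi.single_eq_same] at hs2
  ext ⟨a, v⟩
  simp only [indexSet, Finset.mem_filter, Finset.mem_univ, true_and, Finset.mem_insert,
    Finset.mem_singleton, Prod.mk.injEq]
  by_cases ha : a = i
  · subst ha
    rw [hs1, ← hs2]
    simp only [Pi.single_eq_same, zero_lt_one, true_and]
    constructor
    · rintro ⟨hv, h1, h2⟩
      have : v ∈ Set.range (σ.orderEmbOfFin h) := by simpa using hv
      obtain ⟨j, rfl⟩ := this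
      rw [pos_orderEmb] at h1 h2
      rcases (by omega : j.val = a.val ∨ j.val = a.val + 1) with h3 | h3
      · left; congr 1; exact Fin.ext h3
      · right; congr 1; exact Fin.ext h3
    · rintro (rfl | rfl) <;> refine ⟨Finset.orderEmbOfFin_mem _ _ _, ?_⟩ <;>
        rw [pos_orderEmb] <;> simp
  · simp [ha]

theorem initialDiff_sparseDiff (Δ : LowerSet (Finset (Fin m))) :
    ∀ c ∈ chains k n Δ 1, initialDiff k n m (sparseDiff k n m c) = 0 := by
  suffices h : chains k n Δ 1 ≤ LinearMap.ker ((initialDiff k n m).comp (sparseDiff k n m)) from h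
  refine Submodule.span_le.2 ?_
  rintro _ ⟨α, σ, hα, hc, -, rfl⟩
  obtain ⟨i, rfl⟩ : ∃ i, α = Pi.single i 1 := by
    have : ∃ i, 0 < α i := by
      by_contra! h0
      simp [Finset.sum_eq_zero fun l _ => Nat.le_zero.1 (h0 l)] at hα
    obtain ⟨i, hi⟩ := this
    have hsum := sum_sub_single α i hi Finset.univ
    simp only [Finset.mem_univ, if_true] at hsum
    have hz : ∑ l, (α - Pi.single i 1 : Fin n → ℕ) l = 0 := by omega
    rw [Finset.sum_eq_zero_iff] at hz
    refine ⟨i, funext fun l => ?_⟩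
    have := hz l (Finset.mem_univ _)
    by_cases hl : l = i
    · subst hl
      simp only [Pi.sub_apply, Pi.single_eq_same] at this ⊢
      omega
    · simpa [Pi.single_apply, hl] using this
  simp only [SetLike.mem_coe, LinearMap.mem_ker, LinearMap.comp_apply]
  have hne : (i, σ.orderEmbOfFin hc i.castSucc) ≠ (i, σ.orderEmbOfFin hc i.succ) := by
    intro he
    have := (σ.orderEmbOfFin hc).injective (Prod.mk.inj he).2
    exact (Fin.castSucc_lt_succ (i := i)).ne this
  have hcard : ∀ p, (σ.erase (σ.orderEmbOfFin hc p)).card = n := fun p => by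
    rw [Finset.card_erase_of_mem (Finset.orderEmbOfFin_mem _ _ _), hc]; rfl
  rw [sparseDiff_basisElt, indexSet_single i σ hc, Finset.sum_pair hne, map_add, map_smul,
    map_smul, initialDiff_basisElt _ _ (hcard _), initialDiff_basisElt _ _ (hcard _)]
  simp only [orderEmb_erase, pos_orderEmb, smul_eq_mul, Fin.val_castSucc, Fin.val_succ]
  rw [← Finset.mul_prod_erase _ _ (Finset.mem_univ i),
    ← Finset.mul_prod_erase _ (fun a => x k a (σ.orderEmbOfFin hc (i.succ.succAbove a)))
      (Finset.mem_univ i)]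
  have hrest : ∏ a ∈ Finset.univ.erase i, x k a (σ.orderEmbOfFin hc (i.succ.succAbove a)) =
      ∏ a ∈ Finset.univ.erase i, x k a (σ.orderEmbOfFin hc (i.castSucc.succAbove a)) := by
    refine Finset.prod_congr rfl fun a ha => ?_
    have hai : a.val ≠ i.val := fun he => (Finset.mem_erase.1 ha).1 (Fin.ext he)
    congr 2
    simp only [Fin.succAbove, Fin.lt_def, Fin.val_castSucc, Fin.val_succ]
    split_ifs <;> first | rfl | omega
  rw [hrest, Fin.succAbove_castSucc_self, Fin.succAbove_succ_self]
  ring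

end

/-- The modules of the complex `C^<_•(Δ, M)`. -/
def complexX (k : Type u) [Field k] (n : ℕ) {m : ℕ} (Δ : LowerSet (Finset (Fin m))) :
    ℕ → ModuleCat.{u} (PolyRing k n m)
  | 0 => ModuleCat.of _ (PolyRing k n m)
  | i + 1 => ModuleCat.of _ (chains k n Δ i)

/-- The differentials of the complex `C^<_•(Δ, M)`. -/
def complexD (k : Type u) [Field k] (n : ℕ) {m : ℕ} (Δ : LowerSet (Finset (Fin m))) :
    (i : ℕ) → (complexX k n Δ (i + 1) ⟶ complexX k n Δ i)
  | 0 => ModuleCat.ofHom ((initialDiff k n m).domRestrict (chains k n Δ 0))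
  | i + 1 => ModuleCat.ofHom ((sparseDiff k n m).restrict (sparseDiff_mem Δ i))

theorem complexD_comp (k : Type u) [Field k] (n : ℕ) {m : ℕ} (Δ : LowerSet (Finset (Fin m)))
    (i : ℕ) : complexD k n Δ (i + 1) ≫ complexD k n Δ i = 0 := by
  cases i with
  | zero =>
    refine ModuleCat.hom_ext (LinearMap.ext fun c => ?_)
    exact initialDiff_sparseDiff Δ c.1 c.2
  | succ i =>
    refine ModuleCat.hom_ext (LinearMap.ext fun c => ?_)
    exact Subtype.ext (sparseDiff_sparseDiff c.1)

/-- The generalized sparse Eagon-Northcott complex `C^<_•(Δ, M)`. -/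
def sparseComplex (k : Type u) [Field k] (n : ℕ) {m : ℕ} (Δ : LowerSet (Finset (Fin m))) :
    ChainComplex (ModuleCat.{u} (PolyRing k n m)) ℕ :=
  ChainComplex.of (complexX k n Δ) (complexD k n Δ) (complexD_comp k n Δ)

/-- The elements of internal degree `d` of the `i`-th module of `C^<_•(Δ, M)`, for the standard
grading of the polynomial ring: `⋀ⁿ G` is generated in degree `0`, and for `i ≥ 0` the basis
elements `g^{*(α)} ⊗ f_σ` of `C^<_{i+1}(Δ, M)` have degree `|σ| = n + i`. -/
def homogeneousPart (k : Type u) [Field k] (n : ℕ) {m : ℕ} (Δ : LowerSet (Finset (Fin m)))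
    (d : ℕ) : (i : ℕ) → AddSubgroup ((sparseComplex k n Δ).X i)
  | 0 => (MvPolynomial.homogeneousSubmodule (Fin n ×ₗ Fin m) k d).toAddSubgroup
  | i + 1 =>
    { carrier := {c : chains k n Δ i | ∀ b, ∀ w ∈ (c.1 b).support, w.degree + (n + i) = d}
      zero_mem' := by
        intro b w hw
        exact absurd rfl (MvPolynomial.mem_support_iff.1 hw)
      add_mem' := by
        classical
        intro c c' hc hc' b w hw
        rcases Finset.mem_union.1 (MvPolynomial.support_add hw) with h | h
        · exact hc b w h
        · exact hc' b w h
      neg_mem' := by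
        intro c hc b w hw
        refine hc b w ?_
        rw [MvPolynomial.mem_support_iff] at hw ⊢
        intro h0
        refine hw ?_
        change MvPolynomial.coeff w (-(c.1 b)) = 0
        rw [MvPolynomial.coeff_neg, h0, neg_zero] }

/-- The graded piece `H_i(C^<_•(Δ, M))_d`: the homology classes of the cycles that are
homogeneous of internal degree `d`. -/
def homologyPart (k : Type u) [Field k] (n : ℕ) {m : ℕ} (Δ : LowerSet (Finset (Fin m)))
    (i d : ℕ) : AddSubgroup ((sparseComplex k n Δ).homology i) :=
  ((homogeneousPart k n Δ d i).comap
    ((sparseComplex k n Δ).iCycles i).hom.toAddMonoidHom).map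
    ((sparseComplex k n Δ).homologyπ i).hom.toAddMonoidHom

/-- `σ = {σ_1 < ⋯ < σ_l}` is an `i`-nonface of `Δ`: `σ ∉ Δ`, and for some `j`, the elements
`σ_j, …, σ_{j+i}` of `σ` exist and `σ \ σ_{j+t} ∈ Δ` for all `t = 0, …, i`. -/
def IsNonface {m : ℕ} (Δ : LowerSet (Finset (Fin m))) (i : ℕ) (σ : Finset (Fin m)) : Prop :=
  σ ∉ Δ ∧ ∃ j : ℕ, ∀ t ≤ i, ∃ h : j + t < σ.card,
    σ.erase (σ.orderEmbOfFin rfl ⟨j + t, h⟩) ∈ Δ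

end SparseEN

end

/-!
In internal degree `n + 1`, the free module `C^<_1` has the `k`-basis `x_{au} f_σ` with `σ ∈ Δ`,
`|σ| = n`, and `d_1` maps each of these elements to a monomial. Hence the cycles of degree `n + 1`
are spanned by the differences `x_{au} f_σ - x_{bv} f_τ` whose two terms have the same image.
Comparing the variables in each row of `x_{au} ∏ x_{iσ_i} = x_{bv} ∏ x_{iτ_i}`, such a nonzero
difference exchanges the variables `x_{aσ_a}` and `x_{aτ_a}` in one row `a`. Therefore
`ρ = σ ∪ {τ_a}` has `n + 1` elements, `σ_a` and `τ_a` are consecutive in `ρ`, and the difference is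
up to sign the formal boundary of `g_a^* ⊗ f_ρ`. It is an actual boundary if `ρ ∈ Δ`, and if `ρ` is
not a `1`-nonface of `Δ` then `ρ ∈ Δ`.

Conversely, for a `1`-nonface `ρ` this formal boundary is a cycle of `C^<_•(Δ, M)`. Its coefficient
at `f_{ρ \ v}` is `± x_{av}`, whereas in the boundary of a chain on `Δ` that coefficient lies in the
ideal generated by the variables outside the column `v`, as `ρ ∉ Δ`.
-/

namespace SparseEN

section LinearAlgebra

variable {R M M' ι κ : Type*} [Ring R] [AddCommGroup M] [Module R M] [AddCommGroup M'] [Module R M']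

theorem mem_of_map_eq_zero_of_linearIndependent {b : κ → M'} (hb : LinearIndependent R b)
    (L : M →ₗ[R] M') {v : ι → M} {f : ι → κ} (hL : ∀ i, L (v i) = b (f i)) {N : Submodule R M}
    (hN : ∀ i j, f i = f j → v i - v j ∈ N) {z : M} (hz : z ∈ Submodule.span R (Set.range v))
    (hLz : L z = 0) : z ∈ N := by
  rw [← Finsupp.range_linearCombination] at hz
  obtain ⟨c, rfl⟩ := hz
  have hc : c.mapDomain f = 0 := by
    refine (linearIndependent_iff.1 hb) _ ?_
    rw [Finsupp.linearCombination_mapDomain, ← hLz, Finsupp.apply_linearCombination]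
    exact congrArg (Finsupp.linearCombination R · c) (funext fun i => (hL i).symm)
  -- Modulo `N` the vector `v i` depends on `f i` only, so the class of `z` is a function of
  -- `c.mapDomain f`.
  have hv : Function.FactorsThrough (N.mkQ ∘ v) f := fun i j hij =>
    (Submodule.Quotient.eq N).2 (hN i j hij)
  rw [← N.ker_mkQ, LinearMap.mem_ker, Finsupp.apply_linearCombination,
    ← hv.extend_comp (0 : κ → M ⧸ N), ← Finsupp.linearCombination_mapDomain, hc, map_zero]

theorem mem_span_range_single {z : ι →₀ M} {s : Set ι} (hz : ∀ i ∈ z.support, i ∈ s) {v : κ → M}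
    (hv : ∀ i, z i ∈ Submodule.span R (Set.range v)) :
    z ∈ Submodule.span R (Set.range fun p : s × κ => Finsupp.single (p.1 : ι) (v p.2)) := by
  rw [← Finsupp.sum_single z]
  refine Submodule.sum_mem _ fun i hi => ?_
  have hmap := Submodule.mem_map_of_mem (f := Finsupp.lsingle (R := R) i) (hv i)
  rw [Submodule.map_span] at hmap
  refine Submodule.span_mono ?_ hmap
  rintro _ ⟨_, ⟨e, rfl⟩, rfl⟩
  exact ⟨(⟨i, hz i hi⟩, e), rfl⟩

end LinearAlgebra

section ModuleComplexes

universe v w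

variable {R : Type v} [Ring R] {ι : Type*} {c : ComplexShape ι}
  (K : HomologicalComplex (ModuleCat.{w} R) c)

theorem range_iCycles {j l : ι} (hl : c.next j = l) :
    LinearMap.range (K.iCycles j).hom = LinearMap.ker (K.d j l).hom :=
  ((ShortComplex.mk (K.iCycles j) (K.d j l) (by simp)).exact_of_f_is_kernel
    (K.cyclesIsKernel j l hl)).moduleCat_range_eq_ker

theorem range_toCycles {i j : ι} (hi : c.prev j = i) :
    LinearMap.range (K.toCycles i j).hom = LinearMap.ker (K.homologyπ j).hom :=
  ((ShortComplex.mk (K.toCycles i j) (K.homologyπ j) (by simp)).exact_of_g_is_cokernel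
    (K.homologyIsCokernel i j hi)).moduleCat_range_eq_ker

theorem homologyπ_eq_zero_iff {i j : ι} (hi : c.prev j = i) (y : K.cycles j) :
    (K.homologyπ j).hom y = 0 ↔ ∃ b, (K.d i j).hom b = (K.iCycles j).hom y := by
  have hinj : Function.Injective (K.iCycles j).hom :=
    (ModuleCat.mono_iff_injective _).1 inferInstance
  rw [← LinearMap.mem_ker, ← range_toCycles K hi]
  refine exists_congr fun b => ?_
  rw [← hinj.eq_iff, ← ModuleCat.comp_apply, K.toCycles_i]

end ModuleComplexes

universe u

variable {k : Type u} [Field k] {n m : ℕ}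

section Homology

theorem homologyPart_succ_eq_bot_iff (Δ : LowerSet (Finset (Fin m))) (i d : ℕ) :
    homologyPart k n Δ (i + 1) d = ⊥ ↔
      ∀ z ∈ homogeneousPart k n Δ d (i + 1), ((sparseComplex k n Δ).d (i + 1) i).hom z = 0 →
        ∃ y, ((sparseComplex k n Δ).d (i + 2) (i + 1)).hom y = z := by
  have hcycles := range_iCycles (sparseComplex k n Δ) (j := i + 1) (l := i) (by simp)
  have hboundary := homologyπ_eq_zero_iff (sparseComplex k n Δ) (i := i + 2) (j := i + 1) (by simp)
  rw [homologyPart, AddSubgroup.map_eq_bot_iff]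
  constructor
  · intro h z hz hdz
    obtain ⟨y, rfl⟩ := hcycles.ge hdz
    exact (hboundary y).1 (h hz)
  · intro h y hy
    exact (hboundary y).2 (h _ hy (hcycles.le ⟨y, rfl⟩))

theorem sparseComplex_d_one_zero_apply (Δ : LowerSet (Finset (Fin m))) (z : chains k n Δ 0) :
    ((sparseComplex k n Δ).d 1 0).hom z = initialDiff k n m (z : Ambient k n m) := by
  have hd : (sparseComplex k n Δ).d 1 0 = complexD k n Δ 0 :=
    ChainComplex.of_d (complexX k n Δ) (complexD k n Δ) 0
  rw [hd]
  rfl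

theorem exists_sparseComplex_d_two_one_eq_iff (Δ : LowerSet (Finset (Fin m)))
    (z : chains k n Δ 0) :
    (∃ y, ((sparseComplex k n Δ).d 2 1).hom y = z) ↔
      (z : Ambient k n m) ∈ (chains k n Δ 1).map (sparseDiff k n m) := by
  have hd : (sparseComplex k n Δ).d 2 1 = complexD k n Δ 1 :=
    ChainComplex.of_d (complexX k n Δ) (complexD k n Δ) 1
  rw [hd]
  constructor
  · rintro ⟨y, hy⟩
    exact ⟨_, Subtype.prop (p := (· ∈ chains k n Δ 1)) y, congrArg Subtype.val hy⟩
  · rintro ⟨y, hy, hyz⟩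
    exact ⟨(⟨y, hy⟩ : chains k n Δ 1), Subtype.ext hyz⟩

theorem mem_homogeneousPart_succ_iff (Δ : LowerSet (Finset (Fin m))) (i d : ℕ)
    (z : chains k n Δ i) :
    z ∈ homogeneousPart k n Δ (n + i + d) (i + 1) ↔
      ∀ b, ((z : Ambient k n m) b).IsHomogeneous d := by
  refine forall_congr' fun b => forall_congr' fun w => ?_
  rw [MvPolynomial.mem_support_iff, Finsupp.degree_eq_weight_one, add_comm, add_right_inj]
  rfl

theorem homologyPart_one_eq_bot_iff (Δ : LowerSet (Finset (Fin m))) (d : ℕ) :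
    homologyPart k n Δ 1 (n + d) = ⊥ ↔
      ∀ z ∈ chains k n Δ 0, (∀ b, (z b).IsHomogeneous d) → initialDiff k n m z = 0 →
        z ∈ (chains k n Δ 1).map (sparseDiff k n m) := by
  rw [homologyPart_succ_eq_bot_iff]
  constructor
  · intro h z hz hdeg hdz
    exact (exists_sparseComplex_d_two_one_eq_iff Δ ⟨z, hz⟩).1
      (h _ ((mem_homogeneousPart_succ_iff Δ 0 d ⟨z, hz⟩).2 hdeg)
        ((sparseComplex_d_one_zero_apply Δ ⟨z, hz⟩).trans hdz))
  · rintro h (z : chains k n Δ 0) hdeg hdz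
    exact (exists_sparseComplex_d_two_one_eq_iff Δ z).2
      (h z z.2 ((mem_homogeneousPart_succ_iff Δ 0 d z).1 hdeg)
        ((sparseComplex_d_one_zero_apply Δ z).symm.trans hdz))

end Homology

section Nonfaces

theorem card_erase_orderEmbOfFin (σ : Finset (Fin m)) (hσ : σ.card = n + 1) (p : Fin (n + 1)) :
    (σ.erase (σ.orderEmbOfFin hσ p)).card = n := by
  rw [Finset.card_erase_of_mem (Finset.orderEmbOfFin_mem _ _ _), hσ, Nat.add_sub_cancel]

theorem orderEmbOfFin_castSucc_lt_succ (σ : Finset (Fin m)) (hσ : σ.card = n + 1) (j : Fin n) :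
    σ.orderEmbOfFin hσ j.castSucc < σ.orderEmbOfFin hσ j.succ :=
  (σ.orderEmbOfFin hσ).strictMono Fin.castSucc_lt_succ

theorem isNonface_one_iff (Δ : LowerSet (Finset (Fin m))) (σ : Finset (Fin m))
    (hσ : σ.card = n + 1) :
    IsNonface Δ 1 σ ↔ σ ∉ Δ ∧ ∃ j : Fin n, σ.erase (σ.orderEmbOfFin hσ j.castSucc) ∈ Δ ∧
      σ.erase (σ.orderEmbOfFin hσ j.succ) ∈ Δ := by
  have hcast : ∀ p : Fin (n + 1), σ.orderEmbOfFin rfl ⟨p, by omega⟩ = σ.orderEmbOfFin hσ p :=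
    fun p => by rw [Finset.orderEmbOfFin_eq_orderEmbOfFin_iff]
  refine and_congr_right fun _ => ⟨?_, ?_⟩
  · rintro ⟨j, hj⟩
    obtain ⟨_, hj₀⟩ := hj 0 zero_le_one
    obtain ⟨_, hj₁⟩ := hj 1 le_rfl
    exact ⟨⟨j, by omega⟩, by rwa [← hcast], by rwa [← hcast]⟩
  · rintro ⟨j, hj₀, hj₁⟩
    rw [← hcast] at hj₀ hj₁
    refine ⟨j, fun t ht => ?_⟩
    obtain rfl | rfl : t = 0 ∨ t = 1 := by omega
    · exact ⟨_, hj₀⟩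
    · exact ⟨_, hj₁⟩

theorem orderEmbOfFin_eq_of_pos_eq {σ : Finset (Fin m)} {l : ℕ} (hσ : σ.card = l) {v : Fin m}
    (hv : v ∈ σ) {j : Fin l} (hj : pos σ v = j) : σ.orderEmbOfFin hσ j = v := by
  obtain ⟨i, rfl⟩ : v ∈ Set.range (σ.orderEmbOfFin hσ) := by simpa using hv
  rw [pos_orderEmb] at hj
  rw [Fin.ext hj]

theorem erase_orderEmbOfFin_eq_image (σ : Finset (Fin m)) (hσ : σ.card = n) (a : Fin n) :
    σ.erase (σ.orderEmbOfFin hσ a) = (Finset.univ.erase a).image (σ.orderEmbOfFin hσ) := by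
  rw [Finset.image_erase (σ.orderEmbOfFin hσ).injective, Finset.image_orderEmbOfFin_univ]

theorem erase_orderEmbOfFin_congr {σ τ : Finset (Fin m)} (hσ : σ.card = n) (hτ : τ.card = n)
    {a : Fin n} (h : ∀ i, i ≠ a → σ.orderEmbOfFin hσ i = τ.orderEmbOfFin hτ i) :
    σ.erase (σ.orderEmbOfFin hσ a) = τ.erase (τ.orderEmbOfFin hτ a) := by
  rw [erase_orderEmbOfFin_eq_image, erase_orderEmbOfFin_eq_image]
  exact Finset.image_congr fun i hi => h i (Finset.ne_of_mem_erase hi)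

theorem exists_erase_orderEmbOfFin_eq {σ τ : Finset (Fin m)} (hσ : σ.card = n) (hτ : τ.card = n)
    {a : Fin n} (h : σ.erase (σ.orderEmbOfFin hσ a) = τ.erase (τ.orderEmbOfFin hτ a))
    (hlt : σ.orderEmbOfFin hσ a < τ.orderEmbOfFin hτ a) :
    ∃ (ρ : Finset (Fin m)) (hρ : ρ.card = n + 1),
      ρ.orderEmbOfFin hρ a.castSucc = σ.orderEmbOfFin hσ a ∧
      ρ.orderEmbOfFin hρ a.succ = τ.orderEmbOfFin hτ a ∧
      ρ.erase (σ.orderEmbOfFin hσ a) = τ ∧ ρ.erase (τ.orderEmbOfFin hτ a) = σ := by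
  have hpos_s : pos σ (σ.orderEmbOfFin hσ a) = a := pos_orderEmb σ hσ a
  have hpos_t : pos τ (τ.orderEmbOfFin hτ a) = a := pos_orderEmb τ hτ a
  have hs : σ.orderEmbOfFin hσ a ∈ σ := Finset.orderEmbOfFin_mem _ _ _
  have ht : τ.orderEmbOfFin hτ a ∈ τ := Finset.orderEmbOfFin_mem _ _ _
  generalize σ.orderEmbOfFin hσ a = s at *
  generalize τ.orderEmbOfFin hτ a = t at *
  have htσ : t ∉ σ := fun hmem =>
    Finset.notMem_erase t τ (h ▸ Finset.mem_erase.2 ⟨hlt.ne', hmem⟩)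
  have hsρ : s ∈ insert t σ := Finset.mem_insert_of_mem hs
  have htρ : t ∈ insert t σ := Finset.mem_insert_self t σ
  have herase_t : (insert t σ).erase t = σ := Finset.erase_insert htσ
  have herase_s : (insert t σ).erase s = τ := by
    rw [Finset.erase_insert_of_ne hlt.ne', h, Finset.insert_erase ht]
  refine ⟨insert t σ, by rw [Finset.card_insert_of_notMem htσ, hσ],
    orderEmbOfFin_eq_of_pos_eq _ hsρ ?_, orderEmbOfFin_eq_of_pos_eq _ htρ ?_, herase_s, herase_t⟩
  · rw [pos_erase _ t s htρ, herase_t, hpos_s, if_neg hlt.asymm, add_zero, Fin.val_castSucc]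
  · rw [pos_erase _ s t hsρ, herase_s, hpos_t, if_pos hlt, Fin.val_succ]

end Nonfaces

section Cycles

/-- The cycle `z` attached to a set `σ` of cardinality `n + 1` and a row `j`: the formal boundary of
`g_j^* ⊗ f_σ`, whether or not `σ ∈ Δ`. It lives in the ambient module, as it does not depend on `Δ`.
The sign is `(-1)^j` because `j` is counted from `0`. -/
noncomputable def nonfaceCycle (k : Type u) [Field k] (σ : Finset (Fin m))
    (hσ : σ.card = n + 1) (j : Fin n) : Ambient k n m :=
  (-1 : PolyRing k n m) ^ (j : ℕ) •
    (x k j (σ.orderEmbOfFin hσ j.castSucc) •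
        basisElt k 0 (σ.erase (σ.orderEmbOfFin hσ j.castSucc)) -
      x k j (σ.orderEmbOfFin hσ j.succ) •
        basisElt k 0 (σ.erase (σ.orderEmbOfFin hσ j.succ)))

variable (σ : Finset (Fin m)) (hσ : σ.card = n + 1) (j : Fin n) {Δ : LowerSet (Finset (Fin m))}

theorem sparseDiff_basisElt_single :
    sparseDiff k n m (basisElt k (Pi.single j 1) σ) = nonfaceCycle k σ hσ j := by
  have hne : (j, σ.orderEmbOfFin hσ j.castSucc) ≠ (j, σ.orderEmbOfFin hσ j.succ) := fun he =>
    (orderEmbOfFin_castSucc_lt_succ σ hσ j).ne (Prod.mk.inj he).2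
  rw [sparseDiff_basisElt, indexSet_single j σ hσ, Finset.sum_pair hne]
  simp only [nonfaceCycle, pos_orderEmb, tsub_self, Fin.val_castSucc, Fin.val_succ, smul_add,
    smul_smul, smul_neg, pow_succ, mul_neg, mul_one, neg_mul, neg_smul, sub_eq_add_neg]

theorem basisElt_single_mem_chains {σ : Finset (Fin m)} (hσ : σ.card = n + 1) (hσΔ : σ ∈ Δ)
    (j : Fin n) : basisElt k (Pi.single j 1) σ ∈ chains k n Δ 1 :=
  Submodule.subset_span ⟨_, σ, by simp, hσ, hσΔ, rfl⟩

theorem nonfaceCycle_mem_map_sparseDiff (hσΔ : σ ∈ Δ) :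
    nonfaceCycle k σ hσ j ∈ (chains k n Δ 1).map (sparseDiff k n m) :=
  ⟨_, basisElt_single_mem_chains hσ hσΔ j, sparseDiff_basisElt_single σ hσ j⟩

theorem initialDiff_nonfaceCycle : initialDiff k n m (nonfaceCycle k σ hσ j) = 0 := by
  rw [← sparseDiff_basisElt_single]
  exact initialDiff_sparseDiff ⊤ _ (basisElt_single_mem_chains hσ (Set.mem_univ σ) j)

theorem nonfaceCycle_mem_chains (h₀ : σ.erase (σ.orderEmbOfFin hσ j.castSucc) ∈ Δ)
    (h₁ : σ.erase (σ.orderEmbOfFin hσ j.succ) ∈ Δ) :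
    nonfaceCycle k σ hσ j ∈ chains k n Δ 0 := by
  have hfacet : ∀ p, σ.erase (σ.orderEmbOfFin hσ p) ∈ Δ →
      basisElt k 0 (σ.erase (σ.orderEmbOfFin hσ p)) ∈ chains k n Δ 0 := fun p hp =>
    Submodule.subset_span ⟨0, _, by simp, card_erase_orderEmbOfFin σ hσ p, hp, rfl⟩
  exact Submodule.smul_mem _ _ (Submodule.sub_mem _ (Submodule.smul_mem _ _ (hfacet _ h₀))
    (Submodule.smul_mem _ _ (hfacet _ h₁)))

theorem isHomogeneous_x_smul_basisElt (i : Fin n) (v : Fin m) (α : Fin n → ℕ)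
    (τ : Finset (Fin m)) (b : (Fin n → ℕ) × Finset (Fin m)) :
    ((x k i v • basisElt k α τ) b).IsHomogeneous 1 := by
  classical
  rw [basisElt, Finsupp.smul_single, smul_eq_mul, mul_one, Finsupp.single_apply]
  split_ifs
  · exact MvPolynomial.isHomogeneous_X k _
  · exact MvPolynomial.isHomogeneous_zero _ _ _

theorem isHomogeneous_nonfaceCycle (b : (Fin n → ℕ) × Finset (Fin m)) :
    (nonfaceCycle k σ hσ j b).IsHomogeneous 1 := by
  have hsign : ((-1 : PolyRing k n m) ^ (j : ℕ)).IsHomogeneous 0 := by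
    simpa using (MvPolynomial.isHomogeneous_one (Fin n ×ₗ Fin m) k).neg.pow (j : ℕ)
  rw [nonfaceCycle, Finsupp.smul_apply, Finsupp.sub_apply, smul_eq_mul]
  simpa only [zero_add] using hsign.mul ((isHomogeneous_x_smul_basisElt j _ 0 _ b).sub
    (isHomogeneous_x_smul_basisElt j _ 0 _ b))

variable {σ}

theorem eval_sparseDiff_apply_erase_eq_zero {v : Fin m} (hv : v ∈ σ) (hσΔ : σ ∉ Δ)
    (β : Fin n → ℕ) {P : Fin n ×ₗ Fin m → k} (hP : ∀ i w, w ≠ v → P (toLex (i, w)) = 0) {q : ℕ}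
    {c : Ambient k n m} (hc : c ∈ chains k n Δ q) :
    MvPolynomial.eval P (sparseDiff k n m c (β, σ.erase v)) = 0 := by
  suffices hle : chains k n Δ q ≤ Submodule.comap
      ((Finsupp.lapply (β, σ.erase v)).comp (sparseDiff k n m))
      (RingHom.ker (MvPolynomial.eval P)) from hle hc
  refine Submodule.span_le.2 ?_
  rintro _ ⟨α, ρ, -, -, hρ, rfl⟩
  change MvPolynomial.eval P (sparseDiff k n m (basisElt k α ρ) (β, σ.erase v)) = 0
  rw [sparseDiff_basisElt, Finsupp.finsetSum_apply, map_sum]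
  refine Finset.sum_eq_zero fun ⟨i, w⟩ hp => ?_
  rw [Finsupp.smul_apply, smul_eq_mul, map_mul, map_mul, MvPolynomial.eval_X]
  by_cases hw : w = v
  · subst hw
    have hwρ : w ∈ ρ := (Finset.mem_filter.1 hp).2.2.1
    have hne : ρ.erase w ≠ σ.erase w := fun he => hσΔ <| by
      rwa [← Finset.insert_erase hv, ← he, Finset.insert_erase hwρ]
    rw [basisElt, Finsupp.single_eq_of_ne fun he => hne (Prod.mk.inj he).2.symm, map_zero, mul_zero]
  · rw [hP i w hw, mul_zero, zero_mul]

theorem nonfaceCycle_notMem_map_sparseDiff (hσΔ : σ ∉ Δ) (q : ℕ) :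
    nonfaceCycle k σ hσ j ∉ (chains k n Δ q).map (sparseDiff k n m) := by
  rintro ⟨y, hy, hyz⟩
  have hmem : ∀ p, σ.orderEmbOfFin hσ p ∈ σ := Finset.orderEmbOfFin_mem σ hσ
  have hne : σ.erase (σ.orderEmbOfFin hσ j.succ) ≠ σ.erase (σ.orderEmbOfFin hσ j.castSucc) :=
    fun he => (orderEmbOfFin_castSucc_lt_succ σ hσ j).ne'
      ((Finset.erase_injOn σ) (hmem _) (hmem _) he)
  have hzero := eval_sparseDiff_apply_erase_eq_zero (hmem j.castSucc) hσΔ 0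
    (P := Pi.single (toLex (j, σ.orderEmbOfFin hσ j.castSucc)) (1 : k))
    (fun i w hw => Pi.single_eq_of_ne (fun he => hw (Prod.mk.inj (toLex.injective he)).2) 1) hy
  rw [hyz, nonfaceCycle] at hzero
  simp [basisElt, hne] at hzero

end Cycles

section Exchange

theorem rowExp_row_eq {s t : Fin n → Fin m} {a b : Fin n} {u v : Fin m}
    (h : rowExp s + Finsupp.single (toLex (a, u)) 1 =
      rowExp t + Finsupp.single (toLex (b, v)) 1) (i : Fin n) :
    (Finsupp.single (s i) 1 + if a = i then Finsupp.single u 1 else 0 : Fin m →₀ ℕ) =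
      Finsupp.single (t i) 1 + if b = i then Finsupp.single v 1 else 0 := by
  ext w
  have hw := DFunLike.congr_fun h (toLex (i, w))
  simp only [Finsupp.add_apply, rowExp_apply, Finsupp.single_apply, toLex_inj, Prod.mk.injEq,
    ite_and] at hw
  simp only [Finsupp.add_apply, Finsupp.single_apply]
  split_ifs at hw ⊢ <;> simp_all

theorem eq_or_exchange_of_rowExp_add_single_eq {s t : Fin n → Fin m} {a b : Fin n} {u v : Fin m}
    (h : rowExp s + Finsupp.single (toLex (a, u)) 1 =
      rowExp t + Finsupp.single (toLex (b, v)) 1) :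
    a = b ∧ (∀ i, i ≠ a → s i = t i) ∧ (s a = t a ∧ u = v ∨ s a = v ∧ u = t a) := by
  obtain rfl : b = a := by
    have hdeg := congrArg Finsupp.degree (rowExp_row_eq h a)
    by_contra hne
    simp [hne] at hdeg
  refine ⟨rfl, fun i hi => ?_, ?_⟩
  · simpa [hi.symm, Finsupp.single_left_inj] using rowExp_row_eq h i
  · simpa [Finsupp.single_add_single_eq_single_add_single] using rowExp_row_eq h b

variable {Δ : LowerSet (Finset (Fin m))} {σ τ : Finset (Fin m)}

theorem exchange_mem_map_sparseDiff
    (hΔ : ∀ ρ : Finset (Fin m), ρ.card = n + 1 → ¬ IsNonface Δ 1 ρ)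
    (hσ : σ.card = n) (hτ : τ.card = n) (hσΔ : σ ∈ Δ) (hτΔ : τ ∈ Δ) {a : Fin n}
    (h : σ.erase (σ.orderEmbOfFin hσ a) = τ.erase (τ.orderEmbOfFin hτ a))
    (hlt : σ.orderEmbOfFin hσ a < τ.orderEmbOfFin hτ a) :
    x k a (σ.orderEmbOfFin hσ a) • basisElt k (0 : Fin n → ℕ) τ -
        x k a (τ.orderEmbOfFin hτ a) • basisElt k 0 σ ∈
      (chains k n Δ 1).map (sparseDiff k n m) := by
  obtain ⟨ρ, hρ, hs, ht, herase_s, herase_t⟩ := exists_erase_orderEmbOfFin_eq hσ hτ h hlt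
  have hρΔ : ρ ∈ Δ := by
    by_contra hρΔ
    refine hΔ ρ hρ ((isNonface_one_iff Δ ρ hρ).2 ⟨hρΔ, a, ?_, ?_⟩)
    · rwa [hs, herase_s]
    · rwa [ht, herase_t]
  have hmem := Submodule.smul_mem _ ((-1 : PolyRing k n m) ^ (a : ℕ))
    (nonfaceCycle_mem_map_sparseDiff (k := k) ρ hρ a hρΔ)
  rwa [nonfaceCycle, hs, ht, herase_s, herase_t, smul_smul, ← mul_pow, neg_one_mul, neg_neg,
    one_pow, one_smul] at hmem

theorem sub_mem_map_sparseDiff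
    (hΔ : ∀ ρ : Finset (Fin m), ρ.card = n + 1 → ¬ IsNonface Δ 1 ρ)
    (hσ : σ.card = n) (hτ : τ.card = n) (hσΔ : σ ∈ Δ) (hτΔ : τ ∈ Δ) {a b : Fin n} {u v : Fin m}
    (h : rowExp (σ.orderEmbOfFin hσ) + Finsupp.single (toLex (a, u)) 1 =
      rowExp (τ.orderEmbOfFin hτ) + Finsupp.single (toLex (b, v)) 1) :
    x k a u • basisElt k (0 : Fin n → ℕ) σ - x k b v • basisElt k 0 τ ∈
      (chains k n Δ 1).map (sparseDiff k n m) := by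
  obtain ⟨rfl, hrows, hrow⟩ := eq_or_exchange_of_rowExp_add_single_eq h
  have herase := erase_orderEmbOfFin_congr hσ hτ hrows
  rcases lt_trichotomy (σ.orderEmbOfFin hσ a) (τ.orderEmbOfFin hτ a) with hlt | heq | hgt
  · obtain ⟨rfl, rfl⟩ := hrow.resolve_left fun hst => hlt.ne hst.1
    rw [← neg_sub]
    exact Submodule.neg_mem _ (exchange_mem_map_sparseDiff hΔ hσ hτ hσΔ hτΔ herase hlt)
  · obtain rfl : u = v := hrow.elim And.right fun hst => hst.2.trans (heq.symm.trans hst.1)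
    obtain rfl : σ = τ := by
      rw [← Finset.insert_erase (Finset.orderEmbOfFin_mem σ hσ a), herase, heq,
        Finset.insert_erase (Finset.orderEmbOfFin_mem τ hτ a)]
    rw [sub_self]
    exact Submodule.zero_mem _
  · obtain ⟨rfl, rfl⟩ := hrow.resolve_left fun hst => hgt.ne' hst.1
    exact exchange_mem_map_sparseDiff hΔ hτ hσ hτΔ hσΔ herase.symm hgt

end Exchange

section LinearCycles

theorem prod_x_eq_monomial_rowExp (c : Fin n → Fin m) :
    ∏ i, x k i (c i) = MvPolynomial.monomial (rowExp c) 1 := by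
  rw [rowExp, MvPolynomial.monomial_sum_one]
  rfl

theorem initialDiff_x_smul_basisElt (a : Fin n) (u : Fin m) (α : Fin n → ℕ) (σ : Finset (Fin m))
    (hσ : σ.card = n) :
    initialDiff k n m (x k a u • basisElt k α σ) = MvPolynomial.monomial
      (rowExp (σ.orderEmbOfFin hσ) + Finsupp.single (toLex (a, u)) 1) 1 := by
  rw [map_smul, initialDiff_basisElt α σ hσ, prod_x_eq_monomial_rowExp, smul_eq_mul,
    x, MvPolynomial.X, MvPolynomial.monomial_mul, one_mul, add_comm]

theorem chains_le_supported (Δ : LowerSet (Finset (Fin m))) (i : ℕ) :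
    chains k n Δ i ≤ Finsupp.supported (PolyRing k n m) (PolyRing k n m)
      {b | ∑ l, b.1 l = i ∧ b.2.card = n + i ∧ b.2 ∈ Δ} := by
  refine Submodule.span_le.2 ?_
  rintro _ ⟨α, σ, hα, hσ, hσΔ, rfl⟩
  exact Finsupp.single_mem_supported _ _ ⟨hα, hσ, hσΔ⟩

theorem mem_span_x_smul_basisElt {Δ : LowerSet (Finset (Fin m))} {z : Ambient k n m}
    (hz : z ∈ chains k n Δ 0) (hdeg : ∀ b, (z b).IsHomogeneous 1) :
    z ∈ Submodule.span k (Set.range fun p : {σ // σ.card = n ∧ σ ∈ Δ} × (Fin n × Fin m) =>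
      x k p.2.1 p.2.2 • basisElt k (0 : Fin n → ℕ) p.1.1) := by
  refine Submodule.span_mono ?_ (mem_span_range_single (R := k)
    (fun _ hb => (Finsupp.mem_supported _ _).1 (chains_le_supported Δ 0 hz) hb)
    (v := (MvPolynomial.X : Fin n ×ₗ Fin m → PolyRing k n m)) fun b => ?_)
  · rintro _ ⟨⟨⟨⟨α, σ⟩, hα, hσ⟩, e⟩, rfl⟩
    obtain rfl : α = 0 := funext fun i => Finset.sum_eq_zero_iff.1 hα i (Finset.mem_univ i)
    refine ⟨(⟨σ, hσ⟩, ofLex e), ?_⟩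
    simp [x, basisElt]
  · rw [← MvPolynomial.homogeneousSubmodule_one_eq_span_X]
    exact hdeg b

theorem mem_map_sparseDiff_of_initialDiff_eq_zero {Δ : LowerSet (Finset (Fin m))}
    (hΔ : ∀ ρ : Finset (Fin m), ρ.card = n + 1 → ¬ IsNonface Δ 1 ρ) {z : Ambient k n m}
    (hz : z ∈ chains k n Δ 0) (hdeg : ∀ b, (z b).IsHomogeneous 1)
    (hdz : initialDiff k n m z = 0) : z ∈ (chains k n Δ 1).map (sparseDiff k n m) :=
  mem_of_map_eq_zero_of_linearIndependent
    (N := ((chains k n Δ 1).map (sparseDiff k n m)).restrictScalars k)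
    (MvPolynomial.basisMonomials (Fin n ×ₗ Fin m) k).linearIndependent
    ((initialDiff k n m).restrictScalars k)
    (f := fun p => rowExp (p.1.1.orderEmbOfFin p.1.2.1) + Finsupp.single (toLex p.2) 1)
    (fun p => initialDiff_x_smul_basisElt p.2.1 p.2.2 0 p.1.1 p.1.2.1)
    (fun p q hpq => sub_mem_map_sparseDiff hΔ p.1.2.1 q.1.2.1 p.1.2.2 q.1.2.2 hpq)
    (mem_span_x_smul_basisElt hz hdeg) hdz

end LinearCycles

end SparseEN

open SparseEN in
theorem mainTheorem6 {k : Type*} [Field k] {n m : ℕ} (hnm : n ≤ m)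
    (Δ : LowerSet (Finset (Fin m))) :
    (homologyPart k n Δ 1 (n + 1) = ⊥ ↔
      ¬ ∃ σ : Finset (Fin m), σ.card = n + 1 ∧ IsNonface Δ 1 σ) ∧
    (∀ (σ : Finset (Fin m)) (hσ : σ.card = n + 1) (j : Fin n), σ ∉ Δ →
      σ.erase (σ.orderEmbOfFin hσ j.castSucc) ∈ Δ →
      σ.erase (σ.orderEmbOfFin hσ j.succ) ∈ Δ →
      ∃ z : chains k n Δ 0,
        (z : Ambient k n m) = (-1 : PolyRing k n m) ^ (j : ℕ) •
          (x k j (σ.orderEmbOfFin hσ j.castSucc) •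
              basisElt k 0 (σ.erase (σ.orderEmbOfFin hσ j.castSucc)) -
            x k j (σ.orderEmbOfFin hσ j.succ) •
              basisElt k 0 (σ.erase (σ.orderEmbOfFin hσ j.succ))) ∧
        ((sparseComplex k n Δ).d 1 0).hom z = 0 ∧
        ¬ ∃ y, ((sparseComplex k n Δ).d 2 1).hom y = z) := by
  refine ⟨?_, fun σ hσ j hσΔ h₀ h₁ => ?_⟩
  · rw [homologyPart_one_eq_bot_iff]
    constructor
    · rintro hexact ⟨σ, hσ, hnonface⟩
      obtain ⟨hσΔ, j, h₀, h₁⟩ := (isNonface_one_iff Δ σ hσ).1 hnonface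
      exact nonfaceCycle_notMem_map_sparseDiff hσ j hσΔ 1
        (hexact _ (nonfaceCycle_mem_chains σ hσ j h₀ h₁) (isHomogeneous_nonfaceCycle σ hσ j)
          (initialDiff_nonfaceCycle σ hσ j))
    · intro hΔ z hz hdeg hdz
      exact mem_map_sparseDiff_of_initialDiff_eq_zero (fun σ hσ hnonface => hΔ ⟨σ, hσ, hnonface⟩)
        hz hdeg hdz
  · let z : chains k n Δ 0 := ⟨nonfaceCycle k σ hσ j, nonfaceCycle_mem_chains σ hσ j h₀ h₁⟩
    refine ⟨z, rfl, ?_, ?_⟩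
    · exact (sparseComplex_d_one_zero_apply Δ z).trans (initialDiff_nonfaceCycle σ hσ j)
    · rw [exists_sparseComplex_d_two_one_eq_iff]
      exact nonfaceCycle_notMem_map_sparseDiff hσ j hσΔ 1
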